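/- Let $R$ be a commutative artinian ring and let $A$ be an artin $R$-algebra, i.e. an $R$-algebra that is finitely generated as an $R$-module. Modules are finitely generated left modules. Suppose that $A$ is connected (nonzero, and not the direct sum of two proper two-sided ideals) and Nakayama: every indecomposable projective and every indecomposable injective $A$-module is uniserial, that is, has a unique composition series. Let $S_1,\dots,S_n$ be a complete set of representatives of the pairwise non-isomorphic simple $A$-modules, so $n=n(A)$ is their number, let $P_j$ be the projective cover of $S_j$, and let $C_A=(c_{jk})$ be the Cartan matrix of $A$: the $n\times n$ integer matrix in which $c_{jk}$ is the multiplicity of $S_j$ in a composition series of $P_k$. Write $l(M)$ for the composition length of a module $M$, and $\mathrm{gl.dim}\,A$ for the global dimension of $A$, the supremum of the projective dimensions of the $A$-modules. Then: (1) $\mathrm{gl.dim}\,A<\infty$ if and only if $\det C_A=1$; (2) if $\mathrm{gl.dim}\,A<\infty$, then $\mathrm{gl.dim}\,A\le 2n(A)-2$ and $\max_{1\le j\le n} l(P_j)\le 2n(A)-1$; moreover the Loewy length of $A$ (the least $k$ with $\mathrm{rad}(A)^k=0$) is at most $2n(A)-1$. -/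

import Mathlib

universe u v

namespace NakayamaAlgebra

open CategoryTheory

section Modules

variable {A : Type u} [Ring A] {M : Type v} [AddCommGroup M] [Module A M]

/-- The simple factors of a composition series of submodules that are isomorphic to `S`, counted
with multiplicity. -/
noncomputable def factorCount (s : CompositionSeries (Submodule A M))
    (S : Type v) [AddCommGroup S] [Module A S] : ℕ :=
  Nat.card {i : Fin s.length //
    Nonempty ((s i.succ ⧸ (s i.castSucc).submoduleOf (s i.succ)) ≃ₗ[A] S)}

/-- A composition series of the module `M`, running from `0` to `M`. -/
def IsFullSeries (s : CompositionSeries (Submodule A M)) : Prop :=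
  s.head = ⊥ ∧ s.last = ⊤

/-- The number of factors isomorphic to `S` is the same in all composition series of `M`. -/
theorem factorCount_eq {s t : CompositionSeries (Submodule A M)} (hs : IsFullSeries s)
    (ht : IsFullSeries t) (S : Type v) [AddCommGroup S] [Module A S] :
    factorCount s S = factorCount t S := by
  obtain ⟨e, he⟩ := s.jordan_holder t (hs.1.trans ht.1.symm) (hs.2.trans ht.2.symm)
  refine Nat.card_congr (e.subtypeEquiv fun i => ?_)
  have key := JordanHolderLattice.Iso.rel
    (fun x y : Submodule A M × Submodule A M =>
      Nonempty ((x.2 ⧸ x.1.submoduleOf x.2) ≃ₗ[A] (y.2 ⧸ y.1.submoduleOf y.2)))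
    (fun {x} => ⟨LinearEquiv.refl A _⟩) (fun {x y} ⟨f⟩ => ⟨f.symm⟩)
    (fun {x y z} ⟨f⟩ ⟨g⟩ => ⟨f.trans g⟩)
    (fun {x y} _ => by
      have h : Submodule.submoduleOf (x ⊓ y) y = Submodule.submoduleOf (y ⊓ x) y := by
        rw [inf_comm]
      have h' : Nonempty ((y ⧸ Submodule.submoduleOf (y ⊓ x) y) ≃ₗ[A]
          ((y ⊔ x : Submodule A M) ⧸ Submodule.submoduleOf x (y ⊔ x))) :=
        ⟨LinearMap.quotientInfEquivSupQuotient y x⟩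
      dsimp only
      rw [sup_comm, inf_comm]
      exact h'.map LinearEquiv.symm) (he i)
  obtain ⟨f⟩ := key
  exact ⟨fun ⟨g⟩ => ⟨f.symm.trans g⟩, fun ⟨g⟩ => ⟨f.trans g⟩⟩

open Classical in
/-- The multiplicity of `S` as a factor in a composition series of `M` (zero if `M` has no
composition series). -/
noncomputable def multiplicity (A : Type u) [Ring A] (S M : Type v) [AddCommGroup S] [Module A S]
    [AddCommGroup M] [Module A M] : ℕ :=
  if h : ∃ s : CompositionSeries (Submodule A M), IsFullSeries s then factorCount h.choose S else 0

theorem multiplicity_eq {s : CompositionSeries (Submodule A M)} (hs : IsFullSeries s)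
    (S : Type v) [AddCommGroup S] [Module A S] : multiplicity A S M = factorCount s S := by
  have h : ∃ s : CompositionSeries (Submodule A M), IsFullSeries s := ⟨s, hs⟩
  rw [multiplicity, dif_pos h]
  exact factorCount_eq h.choose_spec hs S

variable (A M) in
/-- A module is uniserial if it has a unique composition series. -/
def IsUniserial : Prop :=
  ∃! s : CompositionSeries (Submodule A M), IsFullSeries s

variable (A M) in
/-- A module is indecomposable if it is nonzero and not the direct sum of two nonzero submodules. -/
def IsIndecomposable : Prop :=
  Nontrivial M ∧ ∀ N K : Submodule A M, IsCompl N K → N = ⊥ ∨ K = ⊥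

/-- `f : P → M` is a projective cover: `P` is projective and `f` is an epimorphism whose kernel is
superfluous. -/
structure IsProjectiveCover {P : Type v} [AddCommGroup P] [Module A P] (f : P →ₗ[A] M) : Prop where
  projective : Module.Projective A P
  surjective : Function.Surjective f
  superfluous : ∀ N : Submodule A P, N ⊔ LinearMap.ker f = ⊤ → N = ⊤

end Modules

/-- A ring is connected if it is nonzero and not the direct sum of two proper two-sided ideals. -/
def IsConnected (A : Type u) [Ring A] : Prop :=
  Nontrivial A ∧ ∀ I J : TwoSidedIdeal A, IsCompl I J → I = ⊤ ∨ J = ⊤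

/-- An algebra is Nakayama if its (finitely generated left) indecomposable projective modules and
its indecomposable injective modules are uniserial. -/
structure IsNakayama (A : Type u) [Ring A] : Prop where
  uniserial_of_projective : ∀ (M : Type u) [AddCommGroup M] [Module A M], Module.Finite A M →
    IsIndecomposable A M → Module.Projective A M → IsUniserial A M
  uniserial_of_injective : ∀ (M : Type u) [AddCommGroup M] [Module A M], Module.Finite A M →
    IsIndecomposable A M → Module.Injective A M → IsUniserial A M

/-- The global dimension: the supremum of the projective dimensions of the finitely generated left
modules. -/
noncomputable def globalDimension (A : Type u) [Ring A] : WithBot ℕ∞ :=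
  ⨆ (M : ModuleCat.{u} A) (_ : Module.Finite A M), projectiveDimension M

/-- The Loewy length: the least `k` with `rad(A) ^ k = 0` (the radical of an artin algebra is
nilpotent). -/
noncomputable def loewyLength (A : Type u) [Ring A] : ℕ :=
  sInf {k : ℕ | Ring.jacobson A ^ k = ⊥}

/-- `S 0, …, S (n - 1)` is a complete set of representatives of the isomorphism classes of simple
left `A`-modules, without repetition. In particular `n` is the number of these classes. -/
structure IsCompleteSimples (A : Type u) [Ring A] {n : ℕ} (S : Fin n → ModuleCat.{u} A) :
    Prop where
  simple : ∀ j, IsSimpleModule A (S j)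
  injective : ∀ j k, Nonempty (S j ≃ₗ[A] S k) → j = k
  complete : ∀ (T : Type u) [AddCommGroup T] [Module A T], IsSimpleModule A T →
    ∃ j, Nonempty (T ≃ₗ[A] S j)

/-- The Cartan matrix: the entry at `(j, k)` is the multiplicity of `S j` in a composition series
of `P k`, where `P k` is the projective cover of `S k`. -/
noncomputable def cartanMatrix (A : Type u) [Ring A] {n : ℕ} (S P : Fin n → ModuleCat.{u} A) :
    Matrix (Fin n) (Fin n) ℤ :=
  Matrix.of fun j k => (multiplicity A (S j) (P k) : ℤ)

end NakayamaAlgebra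

/-! Uniseriality makes rad P_j, when nonzero, a quotient of some P_{τ j}. So the factors of P_k from
the top are S_{τ^a k} for a < c_k = l(P_k), and c_k ≤ c_{τ k} + 1.

Fix i, give position a the class τ^a i, and put f(a) = a + c(τ^a i) (`advance`), a monotone map. A
quotient of the projective at a is an interval [a,b) with b ≤ f(a); its syzygies are [b,f(a)),
[f(a),f(b)), and so on. Hence its projective dimension is finite iff iterates of f merge b with a or
with f(a) (`resolvesIn_iff` links this to modules). On classes f acts as `jump`; after n-1 steps
classes are `jump`-periodic, `jump` is injective there, and equal classes keep their distance. So
all merging is over after n-1 double syzygies: simples, hence all modules, have dimension at most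
2n-2. Moreover no periodic position then lies strictly between a periodic a and f(a), which bounds
the lengths and thereby the Loewy length.

The Cartan matrix is `intervalMatrix` at t = 1. Finite resolutions put every basis vector in its
integer column span, so det = ±1; the deformation with weights t^a excludes -1. Conversely, count in
each P_k the unit steps whose ends never merge (`weight`). If det = 1, the maximal count divides 1,
and counts at most 1 force every simple to be resolved. -/

namespace NakayamaAlgebra

open Function

/-! ### Dynamics of interval endpoints along τ-orbits -/

section Combinatorics

variable {I : Type*} (τ : I → I) (c : I → ℕ)

/-- The map `a ↦ a + c (τ^a i)` on the positions of the `τ`-orbit of `i`. -/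
def advance (i : I) (a : ℕ) : ℕ := a + c (τ^[a] i)

/-- The induced map `i ↦ τ^(c i) i` on indices. -/
def jump (i : I) : I := τ^[c i] i

/-- The condition that the combinatorial resolution of the interval module with top `i` and length
`l` stops after at most `d` steps. -/
def ResolvesIn : ℕ → I → ℕ → Prop
  | 0, i, l => l = c i
  | d + 1, i, l => l = c i ∨ ResolvesIn d (τ^[l] i) (c i - l)

/-- Every simple interval module has a finite combinatorial resolution. -/
def IsResolved : Prop := ∀ i, ∃ d, ResolvesIn τ c d i 1

variable {τ c}

theorem ResolvesIn.succ {d : ℕ} {i : I} {l : ℕ} (h : ResolvesIn τ c d i l) :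
    ResolvesIn τ c (d + 1) i l := by
  induction d generalizing i l with
  | zero => exact Or.inl h
  | succ d ih => exact h.imp_right ih

theorem le_advance (i : I) (a : ℕ) : a ≤ advance τ c i a := Nat.le_add_right _ _

/-- One step to the right shortens the projective by at most one, so its right end never moves left.
-/
theorem advance_monotone (hc : ∀ i, c i ≤ c (τ i) + 1) (i : I) : Monotone (advance τ c i) := by
  refine monotone_nat_of_le_succ fun a => ?_
  have := hc (τ^[a] i)
  rw [← iterate_succ_apply' τ, Nat.succ_eq_add_one] at this
  simp only [advance]
  omega

theorem le_add_iterate (hc : ∀ i, c i ≤ c (τ i) + 1) (i : I) (l : ℕ) :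
    c i ≤ l + c (τ^[l] i) := by
  simpa [advance] using advance_monotone hc i (Nat.zero_le l)

/-- Position a in the orbit of τ^s i is position s + a in the orbit of i; this translation reduces
questions to position 0. -/
theorem advance_add (i : I) (s a : ℕ) :
    s + advance τ c (τ^[s] i) a = advance τ c i (s + a) := by
  rw [advance, advance, ← iterate_add_apply, add_comm a s, add_assoc]

theorem iterate_advance_add (i : I) (s a k : ℕ) :
    s + (advance τ c (τ^[s] i))^[k] a = (advance τ c i)^[k] (s + a) := by
  induction k generalizing a with
  | zero => rfl
  | succ k ih => rw [iterate_succ_apply, iterate_succ_apply, ih, advance_add]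

theorem iterate_advance_class (i : I) (a k : ℕ) :
    τ^[(advance τ c i)^[k] a] i = (jump τ c)^[k] (τ^[a] i) := by
  induction k generalizing a with
  | zero => rfl
  | succ k ih =>
    rw [iterate_succ_apply, iterate_succ_apply, ih, jump, ← iterate_add_apply, advance, add_comm]

/-- Positions of the same class keep their distance. -/
theorem iterate_advance_sub {i : I} {y z : ℕ} (h : τ^[y] i = τ^[z] i) (k : ℕ) :
    (advance τ c i)^[k] z + y = (advance τ c i)^[k] y + z := by
  have h1 := iterate_advance_add (τ := τ) (c := c) i y 0 k
  have h2 := iterate_advance_add (τ := τ) (c := c) i z 0 k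
  rw [h] at h1
  simp only [add_zero] at h1 h2
  omega

/-- In terms of endpoints, taking a syzygy replaces [a,b) by [b,f(a)). -/
theorem resolvesIn_succ_iff {d : ℕ} {i : I} {a b : ℕ} (hab : a ≤ b)
    (_hb : b ≤ advance τ c i a) :
    ResolvesIn τ c (d + 1) (τ^[a] i) (b - a) ↔
      b = advance τ c i a ∨ ResolvesIn τ c d (τ^[b] i) (advance τ c i a - b) := by
  rw [ResolvesIn, ← iterate_add_apply, Nat.sub_add_cancel hab]
  have h1 : c (τ^[a] i) - (b - a) = advance τ c i a - b := by simp only [advance]; omega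
  rw [h1]
  refine or_congr_left ?_
  simp only [advance]
  omega

theorem resolvesIn_zero_iff {i : I} {a b : ℕ} (hab : a ≤ b) :
    ResolvesIn τ c 0 (τ^[a] i) (b - a) ↔ b = advance τ c i a := by
  simp only [ResolvesIn, advance]
  omega

/-- For the syzygy [b,f(a)), either f(a) merges with b, or f(a) merges with f(b); the latter merges
a with b one application of f later. -/
theorem exists_iterate_of_resolvesIn (hc : ∀ i, c i ≤ c (τ i) + 1) {d : ℕ} {i : I} {a b : ℕ}
    (hab : a ≤ b) (hb : b ≤ advance τ c i a) (h : ResolvesIn τ c d (τ^[a] i) (b - a)) :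
    ∃ k, (advance τ c i)^[k] b = (advance τ c i)^[k] a ∨
      (advance τ c i)^[k] b = (advance τ c i)^[k] (advance τ c i a) := by
  induction d generalizing a b with
  | zero => exact ⟨0, Or.inr ((resolvesIn_zero_iff hab).1 h)⟩
  | succ d ih =>
    rcases (resolvesIn_succ_iff hab hb).1 h with h | h
    · exact ⟨0, Or.inr h⟩
    · obtain ⟨k, hk | hk⟩ := ih hb (advance_monotone hc i hab) h
      · exact ⟨k, Or.inr hk.symm⟩
      · exact ⟨k + 1, Or.inl (by simpa only [iterate_succ_apply] using hk.symm)⟩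

/-- Two syzygies turn [a,b) into [f(a),f(b)), so each application of f costs two steps. -/
theorem resolvesIn_of_iterate_eq_advance (hc : ∀ i, c i ≤ c (τ i) + 1) {k : ℕ} {i : I} {a b : ℕ}
    (hab : a ≤ b) (hb : b ≤ advance τ c i a)
    (h : (advance τ c i)^[k] b = (advance τ c i)^[k] (advance τ c i a)) :
    ResolvesIn τ c (2 * k) (τ^[a] i) (b - a) := by
  induction k generalizing a b with
  | zero => exact (resolvesIn_zero_iff hab).2 h
  | succ k ih =>
    have hm := advance_monotone hc i
    refine (resolvesIn_succ_iff hab hb).2 (Or.inr ?_)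
    exact (resolvesIn_succ_iff hb (hm hab)).2 (Or.inr (ih (hm hab) (hm hb) h))

theorem resolvesIn_of_iterate_eq (hc : ∀ i, c i ≤ c (τ i) + 1) {k : ℕ} {i : I} {a b : ℕ}
    (hab : a < b) (hb : b ≤ advance τ c i a)
    (h : (advance τ c i)^[k] b = (advance τ c i)^[k] a) :
    ResolvesIn τ c (2 * k) (τ^[a] i) (b - a) := by
  cases k with
  | zero => exact absurd h hab.ne'
  | succ k =>
    -- One syzygy reduces to the previous lemma for [b,f(a)); this needs 2k + 1 steps, one fewer
    -- than allowed.
    refine ResolvesIn.succ ((resolvesIn_succ_iff (d := 2 * k) hab.le hb).2 (Or.inr ?_))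
    exact resolvesIn_of_iterate_eq_advance hc hb (advance_monotone hc i hab.le) h.symm

theorem one_le_advance_zero (h1 : ∀ i, 1 ≤ c i) (i : I) : 1 ≤ advance τ c i 0 := by
  simpa [advance] using h1 i

theorem exists_resolvesIn_one_iff (hc : ∀ i, c i ≤ c (τ i) + 1) (h1 : ∀ i, 1 ≤ c i) (i : I) :
    (∃ d, ResolvesIn τ c d i 1) ↔
      ∃ k, (advance τ c i)^[k] 1 = (advance τ c i)^[k] 0 ∨
        (advance τ c i)^[k] 1 = (advance τ c i)^[k] (advance τ c i 0) := by
  refine ⟨fun ⟨d, h⟩ => exists_iterate_of_resolvesIn hc zero_le_one (one_le_advance_zero h1 i) h,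
    fun ⟨k, h⟩ => ⟨2 * k, ?_⟩⟩
  rcases h with h | h
  · exact resolvesIn_of_iterate_eq hc zero_lt_one (one_le_advance_zero h1 i) h
  · exact resolvesIn_of_iterate_eq_advance hc zero_le_one (one_le_advance_zero h1 i) h

theorem le_iterate_advance (h1 : ∀ i, 1 ≤ c i) (i : I) (a k : ℕ) :
    a + k ≤ (advance τ c i)^[k] a := by
  induction k with
  | zero => rfl
  | succ k ih =>
    rw [iterate_succ_apply']
    have := h1 (τ^[(advance τ c i)^[k] a] i)
    conv_rhs => rw [advance]
    omega

theorem injOn_iterate_periodicPts (g : I → I) (k : ℕ) : Set.InjOn g^[k] (periodicPts g) :=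
  (bijOn_periodicPts g).injOn.iterate (bijOn_periodicPts g).mapsTo k

section Finite

variable [Fintype I]

theorem exists_iterate_eq_lt_card (g : I → I) (x : I) :
    ∃ a b, a < b ∧ b ≤ Fintype.card I ∧ g^[a] x = g^[b] x := by
  obtain ⟨a, b, hab, h⟩ := Fintype.exists_ne_map_eq_of_card_lt
    (fun k : Fin (Fintype.card I + 1) => g^[k] x) (by simp)
  rcases lt_or_gt_of_ne hab with hlt | hlt
  · exact ⟨a, b, hlt, Nat.lt_succ_iff.1 b.2, h⟩
  · exact ⟨b, a, hlt, Nat.lt_succ_iff.1 a.2, h.symm⟩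

theorem exists_lt_card_iterate_eq (g : I → I) (x : I) (m : ℕ) :
    ∃ m' < Fintype.card I, g^[m'] x = g^[m] x := by
  induction m using Nat.strong_induction_on with
  | _ m ih =>
    by_cases hm : m < Fintype.card I
    · exact ⟨m, hm, rfl⟩
    · obtain ⟨a, b, hab, hb, h⟩ := exists_iterate_eq_lt_card g x
      obtain ⟨m', hm', h'⟩ := ih (m - b + a) (by omega)
      refine ⟨m', hm', ?_⟩
      rw [h', iterate_add_apply, h, ← iterate_add_apply]
      congr 2
      omega

theorem iterate_mem_periodicPts (g : I → I) (x : I) :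
    g^[Fintype.card I - 1] x ∈ periodicPts g := by
  obtain ⟨a, b, hab, hb, h⟩ := exists_iterate_eq_lt_card g x
  refine mk_mem_periodicPts (n := b - a) (by omega) ?_
  rw [IsPeriodicPt, IsFixedPt, ← iterate_add_apply,
    show b - a + (Fintype.card I - 1) = (Fintype.card I - 1 - a) + b by omega,
    iterate_add_apply, ← h, ← iterate_add_apply, Nat.sub_add_cancel (by omega)]

/-- Positions that ever meet have met after `card I - 1` steps. -/
theorem iterate_advance_eq {i : I} {a b k : ℕ}
    (h : (advance τ c i)^[k] a = (advance τ c i)^[k] b) :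
    (advance τ c i)^[Fintype.card I - 1] a = (advance τ c i)^[Fintype.card I - 1] b := by
  set K := Fintype.card I - 1
  have h' : (advance τ c i)^[k] ((advance τ c i)^[K] a) =
      (advance τ c i)^[k] ((advance τ c i)^[K] b) := by
    rw [← iterate_add_apply, ← iterate_add_apply, add_comm, iterate_add_apply, h,
      iterate_add_apply]
  -- After K steps both classes are `jump`-periodic, and k further jumps are injective on periodic
  -- classes.
  have hcl : τ^[(advance τ c i)^[K] a] i = τ^[(advance τ c i)^[K] b] i := by
    have h2 := congrArg (fun m => τ^[m] i) h'
    simp only [iterate_advance_class _ _ k] at h2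
    refine injOn_iterate_periodicPts (jump τ c) k ?_ ?_ h2 <;>
    · rw [iterate_advance_class]
      exact iterate_mem_periodicPts _ _
  have := iterate_advance_sub (c := c) hcl k
  omega

theorem IsResolved.resolvesIn (hG : IsResolved τ c) (hc : ∀ i, c i ≤ c (τ i) + 1)
    (h1 : ∀ i, 1 ≤ c i) (i : I) : ResolvesIn τ c (2 * Fintype.card I - 2) i 1 := by
  rw [show 2 * Fintype.card I - 2 = 2 * (Fintype.card I - 1) by omega]
  obtain ⟨k, h | h⟩ := (exists_resolvesIn_one_iff hc h1 i).1 (hG i)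
  · exact resolvesIn_of_iterate_eq hc zero_lt_one (one_le_advance_zero h1 i)
      (iterate_advance_eq h)
  · exact resolvesIn_of_iterate_eq_advance hc zero_le_one (one_le_advance_zero h1 i)
      (iterate_advance_eq h)

theorem IsResolved.iterate_eq (hG : IsResolved τ c) (hc : ∀ i, c i ≤ c (τ i) + 1)
    (h1 : ∀ i, 1 ≤ c i) (i : I) (b : ℕ) :
    (advance τ c i)^[Fintype.card I - 1] (b + 1) = (advance τ c i)^[Fintype.card I - 1] b ∨
      (advance τ c i)^[Fintype.card I - 1] (b + 1) =
        (advance τ c i)^[Fintype.card I - 1] (advance τ c i b) := by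
  obtain ⟨k, h⟩ := (exists_resolvesIn_one_iff hc h1 (τ^[b] i)).1 (hG _)
  have e1 := iterate_advance_add (τ := τ) (c := c) i b 1 k
  have e2 := iterate_advance_add (τ := τ) (c := c) i b 0 k
  have e3 := iterate_advance_add (τ := τ) (c := c) i b (advance τ c (τ^[b] i) 0) k
  rw [advance_add] at e3
  rw [add_zero] at e2 e3
  rcases h with h | h
  · exact Or.inl (iterate_advance_eq (k := k) (by omega))
  · exact Or.inr (iterate_advance_eq (k := k) (by omega))

/-- Walk from a to b by unit steps. The first one not merged with a lands on the image of f(a), and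
monotonicity then keeps all later ones there. -/
theorem IsResolved.iterate_eq_of_le (hG : IsResolved τ c) (hc : ∀ i, c i ≤ c (τ i) + 1)
    (h1 : ∀ i, 1 ≤ c i) (i : I) {a b : ℕ} (hab : a ≤ b) (hb : b ≤ advance τ c i a) :
    (advance τ c i)^[Fintype.card I - 1] b = (advance τ c i)^[Fintype.card I - 1] a ∨
      (advance τ c i)^[Fintype.card I - 1] b =
        (advance τ c i)^[Fintype.card I - 1] (advance τ c i a) := by
  have hm := (advance_monotone hc i).iterate (Fintype.card I - 1)
  induction b, hab using Nat.le_induction with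
  | base => exact Or.inl rfl
  | succ b hab ih =>
    rcases ih (by omega) with h | h
    · rcases hG.iterate_eq hc h1 i b with h' | h'
      · exact Or.inl (h'.trans h)
      · refine Or.inr (h'.trans ?_)
        rw [← iterate_succ_apply, ← iterate_succ_apply, iterate_succ_apply', h,
          iterate_succ_apply']
    · exact Or.inr (le_antisymm (hm hb) (h ▸ hm (Nat.le_succ b)))

/-- Between periodic classes merging means equality, since `jump` is injective on them. -/
theorem IsResolved.eq_or_eq (hG : IsResolved τ c) (hc : ∀ i, c i ≤ c (τ i) + 1)
    (h1 : ∀ i, 1 ≤ c i) (i : I) {a b : ℕ} (hab : a ≤ b) (hb : b ≤ advance τ c i a)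
    (ha' : τ^[a] i ∈ periodicPts (jump τ c)) (hb' : τ^[b] i ∈ periodicPts (jump τ c)) :
    b = a ∨ b = advance τ c i a := by
  have key : ∀ {x y : ℕ}, τ^[x] i ∈ periodicPts (jump τ c) → τ^[y] i ∈ periodicPts (jump τ c) →
      (advance τ c i)^[Fintype.card I - 1] x = (advance τ c i)^[Fintype.card I - 1] y → x = y := by
    intro x y hx hy h
    have h2 := congrArg (fun m => τ^[m] i) h
    simp only [iterate_advance_class] at h2
    have := iterate_advance_sub (c := c) (injOn_iterate_periodicPts _ _ hx hy h2)
      (Fintype.card I - 1)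
    omega
  refine (hG.iterate_eq_of_le hc h1 i hab hb).imp (key hb' ha') (key hb' ?_)
  have h3 := iterate_advance_class (τ := τ) (c := c) i a 1
  rw [iterate_one, iterate_one] at h3
  rw [h3]
  exact (bijOn_periodicPts _).mapsTo ha'

/-- Jumps go strictly forward, so a `jump`-cycle closes up under τ; pigeonhole on all but the last
τ-step bounds the period. -/
theorem exists_iterate_eq_self (h1 : ∀ i, 1 ≤ c i) {x : I}
    (hx : x ∈ periodicPts (jump τ c)) : ∃ p, 1 ≤ p ∧ p ≤ Fintype.card I ∧ τ^[p] x = x := by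
  obtain ⟨q, hq, hqx⟩ := hx
  have h2 := iterate_advance_class (τ := τ) (c := c) x 0 q
  have h3 := le_iterate_advance (τ := τ) h1 x 0 q
  rw [iterate_zero_apply, hqx.eq] at h2
  obtain ⟨m, hm⟩ : ∃ m, (advance τ c x)^[q] 0 = m + 1 := ⟨_, (Nat.sub_add_cancel (by omega)).symm⟩
  rw [hm, iterate_succ_apply'] at h2
  obtain ⟨m', hm', h4⟩ := exists_lt_card_iterate_eq τ x m
  exact ⟨m' + 1, by omega, hm', by rw [iterate_succ_apply', h4, h2]⟩

theorem IsResolved.length_le (hG : IsResolved τ c) (hc : ∀ i, c i ≤ c (τ i) + 1)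
    (h1 : ∀ i, 1 ≤ c i) (i : I) : c i ≤ 2 * Fintype.card I - 1 := by
  obtain ⟨a, ha, hper⟩ : ∃ a < Fintype.card I, τ^[a] i ∈ periodicPts (jump τ c) := by
    obtain ⟨a, ha, h⟩ := exists_lt_card_iterate_eq τ i
      ((advance τ c i)^[Fintype.card I - 1] 0)
    refine ⟨a, ha, ?_⟩
    rw [h, iterate_advance_class]
    exact iterate_mem_periodicPts _ _
  obtain ⟨p, hp1, hpn, hp⟩ := exists_iterate_eq_self h1 hper
  -- Position a + p has the same periodic class as a, so it cannot lie strictly inside (a, f(a)).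
  -- With a ≤ n - 1 and p ≤ n this gives 2n - 1.
  have hle : advance τ c i a ≤ a + p := by
    by_contra hlt
    have := hG.eq_or_eq hc h1 i (Nat.le_add_right a p) (by omega) hper
      (by rwa [add_comm, iterate_add_apply, hp])
    omega
  have h0 : c i ≤ advance τ c i a := by
    simpa [advance] using advance_monotone hc i (Nat.zero_le a)
  omega

end Finite

end Combinatorics

end NakayamaAlgebra

namespace NakayamaAlgebra

open Function Matrix

/-! ### Counting steps that never merge -/

section Weight

variable {I : Type*} (τ : I → I) (c : I → ℕ)

open Classical in
/-- `1` if the two ends of the unit interval starting at `i` never meet, else `0`. -/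
noncomputable def separated (i : I) : ℕ :=
  if ∃ k, (advance τ c i)^[k] 0 = (advance τ c i)^[k] 1 then 0 else 1

/-- The number of steps in the interval of length `c i` starting at `i` whose ends never meet. -/
noncomputable def weight (i : I) : ℕ := ∑ a ∈ Finset.range (c i), separated τ c (τ^[a] i)

variable {τ c}

theorem exists_iterate_eq_trans {g : ℕ → ℕ} {x y z : ℕ} (h : ∃ k, g^[k] x = g^[k] y)
    (h' : ∃ k, g^[k] y = g^[k] z) : ∃ k, g^[k] x = g^[k] z := by
  obtain ⟨k, hk⟩ := h
  obtain ⟨m, hm⟩ := h'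
  refine ⟨k + m, ?_⟩
  rw [add_comm, iterate_add_apply, hk, ← iterate_add_apply, add_comm, iterate_add_apply, hm,
    ← iterate_add_apply]

theorem exists_iterate_eq_of_separated_eq_zero {i : I} {x y : ℕ} (hxy : x ≤ y)
    (h : ∀ b ∈ Finset.Ico x y, separated τ c (τ^[b] i) = 0) :
    ∃ k, (advance τ c i)^[k] x = (advance τ c i)^[k] y := by
  induction y, hxy using Nat.le_induction with
  | base => exact ⟨0, rfl⟩
  | succ y hxy ih =>
    refine exists_iterate_eq_trans (ih fun b hb => h b ?_) ?_
    · simp only [Finset.mem_Ico] at hb ⊢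
      omega
    · have h2 := h y (by simp [hxy])
      rw [separated] at h2
      split_ifs at h2 with h3
      obtain ⟨k, hk⟩ := h3
      refine ⟨k, ?_⟩
      have e0 := iterate_advance_add (τ := τ) (c := c) i y 0 k
      have e1 := iterate_advance_add (τ := τ) (c := c) i y 1 k
      rw [add_zero] at e0
      omega

/-- Passing from [0,f(0)) to [1,f(1)) drops the step at 0 and gains [f(0),f(1)). If 0 and 1 never
meet, neither do f(0) and f(1), so a separated step is gained. -/
theorem weight_le_weight (hc : ∀ i, c i ≤ c (τ i) + 1) (i : I) :
    weight τ c i ≤ weight τ c (τ i) := by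
  set g : ℕ → ℕ := fun b => separated τ c (τ^[b] i) with hg
  have e0 : weight τ c i = ∑ b ∈ Finset.Ico 0 (advance τ c i 0), g b := by
    simp [weight, advance, hg]
  have e1 : weight τ c (τ i) = ∑ b ∈ Finset.Ico 1 (advance τ c i 1), g b := by
    rw [Finset.sum_Ico_eq_sum_range]
    simp [weight, advance, hg, add_comm 1, iterate_succ_apply]
  have hm := advance_monotone hc i zero_le_one
  have h1 : 1 ≤ advance τ c i 1 := le_advance i 1
  have s0 := Finset.sum_Ico_consecutive g (Nat.zero_le _) hm
  have s1 := Finset.sum_Ico_consecutive g zero_le_one h1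
  have key : g 0 ≤ ∑ b ∈ Finset.Ico (advance τ c i 0) (advance τ c i 1), g b := by
    by_contra hlt
    have hz : ∑ b ∈ Finset.Ico (advance τ c i 0) (advance τ c i 1), g b = 0 := by
      have : g 0 ≤ 1 := by
        simp only [hg, separated]
        split_ifs <;> omega
      omega
    obtain ⟨k, hk⟩ := exists_iterate_eq_of_separated_eq_zero hm (Finset.sum_eq_zero_iff.1 hz)
    have : g 0 = 0 := by
      simp only [hg, separated, iterate_zero_apply]
      exact if_pos ⟨k + 1, hk⟩
    omega
  rw [← Finset.range_eq_Ico, Finset.sum_range_one] at s1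
  omega

/-- Either 0 and 1 meet, or that step is the only separated one in [0,f(0)), so that 1 meets f(0).
-/
theorem isResolved_of_weight_le_one (hc : ∀ i, c i ≤ c (τ i) + 1) (h1 : ∀ i, 1 ≤ c i)
    (hw : ∀ i, weight τ c i ≤ 1) : IsResolved τ c := by
  intro i
  rw [exists_resolvesIn_one_iff hc h1]
  by_cases h : ∃ k, (advance τ c i)^[k] 0 = (advance τ c i)^[k] 1
  · obtain ⟨k, hk⟩ := h
    exact ⟨k, Or.inl hk.symm⟩
  · have h0 : separated τ c (τ^[0] i) = 1 := if_neg h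
    have hwi := hw i
    rw [weight, Finset.range_eq_Ico,
      ← Finset.sum_Ico_consecutive _ zero_le_one (h1 i), ← Finset.range_eq_Ico, Finset.sum_range_one, h0] at hwi
    have hz : ∑ b ∈ Finset.Ico 1 (c i), separated τ c (τ^[b] i) = 0 := by omega
    obtain ⟨k, hk⟩ := exists_iterate_eq_of_separated_eq_zero (h1 i) (Finset.sum_eq_zero_iff.1 hz)
    exact ⟨k, Or.inr (by simpa [advance] using hk)⟩

end Weight

/-! ### The determinant of the interval matrix -/

section Determinant

variable {I : Type*} [Fintype I] [DecidableEq I] (τ : I → I) (c : I → ℕ)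

/-- The matrix whose column `k` lists the classes `τ^a k` for `a < c k`, with weights `t ^ a`. -/
def intervalMatrix {S : Type*} [CommRing S] (t : S) : Matrix I I S :=
  of fun j k => ∑ a ∈ Finset.range (c k), if τ^[a] k = j then t ^ a else 0

variable {τ c}

/-- In the Grothendieck group, a module is its projective cover (a column) minus its syzygy. -/
theorem ResolvesIn.mem_range (hc : ∀ i, c i ≤ c (τ i) + 1) {d : ℕ} {i : I} {l : ℕ}
    (hl : l ≤ c i) (h : ResolvesIn τ c d i l) :
    ∑ a ∈ Finset.range l, (Pi.single (τ^[a] i) 1 : I → ℤ) ∈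
      LinearMap.range (intervalMatrix τ c (1 : ℤ)).mulVecLin := by
  have hcol : ∀ i, ∑ a ∈ Finset.range (c i), (Pi.single (τ^[a] i) 1 : I → ℤ) ∈
      LinearMap.range (intervalMatrix τ c (1 : ℤ)).mulVecLin := fun i => by
    refine ⟨Pi.single i 1, ?_⟩
    rw [mulVecLin_apply, mulVec_single_one]
    ext j
    simp [intervalMatrix, Finset.sum_apply, Pi.single_apply, eq_comm]
  induction d generalizing i l with
  | zero => exact h ▸ hcol i
  | succ d ih =>
    rcases h with h | h
    · exact h ▸ hcol i
    · have h2 := ih (by have := le_add_iterate hc i l; omega) h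
      have h3 := Finset.sum_range_add (fun a => (Pi.single (τ^[a] i) 1 : I → ℤ)) l (c i - l)
      rw [Nat.add_sub_cancel' hl] at h3
      rw [eq_sub_of_add_eq h3.symm]
      refine sub_mem (hcol i) ?_
      simpa only [← iterate_add_apply, add_comm _ l] using h2

theorem IsResolved.isUnit_det (hG : IsResolved τ c) (hc : ∀ i, c i ≤ c (τ i) + 1)
    (h1 : ∀ i, 1 ≤ c i) : IsUnit (intervalMatrix τ c (1 : ℤ)).det := by
  rw [← isUnit_iff_isUnit_det, ← mulVec_surjective_iff_isUnit]
  have : LinearMap.range (intervalMatrix τ c (1 : ℤ)).mulVecLin = ⊤ := by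
    rw [eq_top_iff, ← (Pi.basisFun ℤ I).span_eq, Submodule.span_le]
    rintro _ ⟨i, rfl⟩
    obtain ⟨d, hd⟩ := hG i
    simpa using hd.mem_range hc (h1 i)
  exact LinearMap.range_eq_top.1 this

/-- Column dominance keeps det(1 - sB) nonzero for s in [0,1], and it equals 1 at s = 0. -/
theorem det_one_sub_pos (B : Matrix I I ℝ) (hB : ∀ k, ∑ i, |B i k| < 1) : 0 < (1 - B).det := by
  have hne : ∀ s ∈ Set.Icc (0 : ℝ) 1, (1 - s • B).det ≠ 0 := by
    intro s hs
    refine det_ne_zero_of_sum_col_lt_diag fun k => ?_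
    have h2 : ∀ i ∈ Finset.univ.erase k, ‖(1 - s • B) i k‖ = s * |B i k| := by
      intro i hi
      rw [Matrix.sub_apply, one_apply_ne (Finset.ne_of_mem_erase hi), zero_sub, norm_neg, Matrix.smul_apply,
        smul_eq_mul, Real.norm_eq_abs, abs_mul, abs_of_nonneg hs.1]
    rw [Finset.sum_congr rfl h2, ← Finset.mul_sum]
    have h3 := hB k
    rw [← Finset.add_sum_erase _ _ (Finset.mem_univ k)] at h3
    have h4 : 1 - s * |B k k| ≤ ‖(1 - s • B) k k‖ := by
      rw [Matrix.sub_apply, one_apply_eq, Matrix.smul_apply, smul_eq_mul, Real.norm_eq_abs]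
      have := abs_sub_abs_le_abs_sub (1 : ℝ) (s * B k k)
      rwa [abs_one, abs_mul, abs_of_nonneg hs.1] at this
    refine lt_of_lt_of_le ?_ h4
    have h5 : 0 ≤ |B k k| + ∑ i ∈ Finset.univ.erase k, |B i k| :=
      add_nonneg (abs_nonneg _) (Finset.sum_nonneg fun _ _ => abs_nonneg _)
    nlinarith [hs.1, hs.2]
  by_contra hneg
  have hcont : ContinuousOn (fun s : ℝ => (1 - s • B).det) (Set.Icc 0 1) := by
    refine Continuous.continuousOn (Continuous.matrix_det ?_)
    fun_prop
  obtain ⟨s, hs, h0⟩ := intermediate_value_Icc' zero_le_one hcont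
    (show (0 : ℝ) ∈ Set.Icc _ _ from ⟨by simpa using not_lt.1 hneg, by simp⟩)
  exact hne s hs h0

/-- Multiplying by 1 minus t times the matrix of τ telescopes each column as a geometric series. -/
theorem one_sub_mul_intervalMatrix {S : Type*} [CommRing S] (t : S) :
    (1 - of fun j k => if τ k = j then t else 0) * intervalMatrix τ c t =
      1 - of fun j k => if jump τ c k = j then t ^ c k else 0 := by
  rw [sub_mul, one_mul]
  ext j k
  have h : ((of fun j k => if τ k = j then t else 0) * intervalMatrix τ c t : Matrix I I S) j k =
      ∑ a ∈ Finset.range (c k), if τ^[a + 1] k = j then t ^ (a + 1) else 0 := by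
    simp only [mul_apply, intervalMatrix, of_apply, Finset.mul_sum]
    rw [Finset.sum_comm]
    refine Finset.sum_congr rfl fun a _ => ?_
    simp only [mul_ite, mul_zero, Finset.sum_ite_eq, Finset.mem_univ, if_true, ite_mul, zero_mul,
      iterate_succ_apply', pow_succ']
  rw [Matrix.sub_apply, h, intervalMatrix, of_apply, ← Finset.sum_sub_distrib,
    Finset.sum_range_sub' (fun a => if τ^[a] k = j then t ^ a else 0)]
  simp [one_apply, jump, eq_comm]

/-- For 0 ≤ t < 1 both other determinants in the telescoped identity are positive; dominance fails
at t = 1, which is reached as a limit. -/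
theorem det_intervalMatrix_nonneg (h1 : ∀ i, 1 ≤ c i) :
    0 ≤ (intervalMatrix τ c (1 : ℤ)).det := by
  have hpos : ∀ t ∈ Set.Ico (0 : ℝ) 1, 0 ≤ (intervalMatrix τ c t).det := by
    intro t ht
    have hmul := congrArg det (one_sub_mul_intervalMatrix (τ := τ) (c := c) t)
    rw [det_mul] at hmul
    have hN : 0 < (1 - of fun j k => if τ k = j then t else 0 : Matrix I I ℝ).det := by
      refine det_one_sub_pos _ fun k => ?_
      simpa [apply_ite abs, abs_of_nonneg ht.1] using ht.2
    have hF : 0 < (1 - of fun j k => if jump τ c k = j then t ^ c k else 0 :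
        Matrix I I ℝ).det := by
      refine det_one_sub_pos _ fun k => ?_
      simpa [apply_ite abs, abs_of_nonneg ht.1] using
        pow_lt_one₀ ht.1 ht.2 (Nat.one_le_iff_ne_zero.1 (h1 k))
    rw [← hmul] at hF
    exact (pos_of_mul_pos_right hF hN.le).le
  have hcont : Continuous fun t : ℝ => (intervalMatrix τ c t).det := by
    refine Continuous.matrix_det (continuous_matrix fun i j => ?_)
    simp only [intervalMatrix, of_apply]
    refine continuous_finsetSum _ fun a _ => ?_
    split_ifs <;> fun_prop
  have h2 : (0 : ℝ) ≤ (intervalMatrix τ c (1 : ℝ)).det := by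
    refine ge_of_tendsto (hcont.continuousWithinAt (s := Set.Iio 1) (x := 1)) ?_
    filter_upwards [Ico_mem_nhdsLT (zero_lt_one' ℝ)] with t ht using hpos t ht
  have h3 : (intervalMatrix τ c (1 : ℝ)) =
      (Int.castRingHom ℝ).mapMatrix (intervalMatrix τ c (1 : ℤ)) := by
    ext j k
    simp [intervalMatrix]
  rw [h3, ← RingHom.map_det] at h2
  exact Int.cast_nonneg_iff.1 h2

theorem IsResolved.det_eq_one (hG : IsResolved τ c) (hc : ∀ i, c i ≤ c (τ i) + 1)
    (h1 : ∀ i, 1 ≤ c i) : (intervalMatrix τ c (1 : ℤ)).det = 1 := by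
  have h2 := det_intervalMatrix_nonneg (τ := τ) h1
  rcases Int.isUnit_iff.1 (hG.isUnit_det hc h1) with h | h <;> omega

theorem sum_separated_mul_intervalMatrix (p : I → Prop) [DecidablePred p]
    (hp : ∀ i, p i → p (τ i)) {k : I} (hk : p k) :
    ∑ j : Subtype p, (separated τ c j : ℤ) * intervalMatrix τ c (1 : ℤ) j k = weight τ c k := by
  have hiter : ∀ a, p (τ^[a] k) := fun a => by
    induction a with
    | zero => exact hk
    | succ a ih => rw [iterate_succ_apply']; exact hp _ ih
  simp only [intervalMatrix, of_apply, Finset.mul_sum, one_pow, mul_ite, mul_one, mul_zero, weight,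
    Nat.cast_sum]
  rw [Finset.sum_comm]
  refine Finset.sum_congr rfl fun a _ => ?_
  rw [Finset.sum_eq_single (⟨τ^[a] k, hiter a⟩ : Subtype p)]
  · simp
  · intro b _ hb
    exact if_neg fun h => hb (Subtype.ext h.symm)
  · simp

theorem isResolved_of_det_eq_one (hc : ∀ i, c i ≤ c (τ i) + 1) (h1 : ∀ i, 1 ≤ c i)
    (hdet : (intervalMatrix τ c (1 : ℤ)).det = 1) : IsResolved τ c := by
  refine isResolved_of_weight_le_one hc h1 fun i₀ => ?_
  by_contra hlt
  obtain ⟨m, -, hm⟩ := Finset.exists_max_image Finset.univ (weight τ c) ⟨i₀, Finset.mem_univ _⟩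
  -- Weights do not decrease along τ, so the set of maximal weight is τ-closed and cuts out a
  -- diagonal block B, whose determinant divides 1.
  set p : I → Prop := fun i => weight τ c i = weight τ c m with hp
  have hpτ : ∀ i, p i → p (τ i) := fun i hi =>
    le_antisymm (hm _ (Finset.mem_univ _)) (hi.symm.le.trans (weight_le_weight hc i))
  have hw : 1 < weight τ c m := by
    have := hm i₀ (Finset.mem_univ _)
    omega
  set B := toSquareBlockProp (intervalMatrix τ c (1 : ℤ)) p with hB
  have hdvd : B.det ∣ 1 := by
    rw [← hdet, twoBlockTriangular_det (intervalMatrix τ c (1 : ℤ)) p]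
    · exact dvd_mul_right _ _
    · intro i hi j hj
      have hiter : ∀ a, p (τ^[a] j) := fun a => by
        induction a with
        | zero => exact hj
        | succ a ih => rw [iterate_succ_apply']; exact hpτ _ ih
      simp only [intervalMatrix, of_apply]
      refine Finset.sum_eq_zero fun a _ => if_neg fun h => hi ?_
      exact h ▸ hiter a
  have hvec : (fun j : Subtype p => (separated τ c j : ℤ)) ᵥ* B = fun _ => (weight τ c m : ℤ) := by
    ext k
    exact (sum_separated_mul_intervalMatrix p hpτ k.2).trans (by rw [k.2])
  obtain ⟨j, hj, hj1⟩ : ∃ j, p j ∧ separated τ c j = 1 := by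
    by_contra! hno
    have h2 : weight τ c m = 0 := by
      have hiter : ∀ a, p (τ^[a] m) := fun a => by
        induction a with
        | zero => rfl
        | succ a ih => rw [iterate_succ_apply']; exact hpτ _ ih
      refine Finset.sum_eq_zero fun a _ => ?_
      have := hno _ (hiter a)
      rw [separated] at this ⊢
      split_ifs at this ⊢ <;> simp_all
    omega
  -- The 0-1 row v of separated steps satisfies vB = w(1,…,1). Multiplying by the adjugate and
  -- reading an entry where v is 1 gives w ∣ det B.
  have h3 := congrArg (fun v => (v ᵥ* B.adjugate) ⟨j, hj⟩) hvec
  simp only [vecMul_vecMul, mul_adjugate, vecMul_smul, vecMul_one, Pi.smul_apply, hj1,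
    smul_eq_mul, Nat.cast_one, mul_one] at h3
  have h4 : (weight τ c m : ℤ) ∣ 1 := by
    refine dvd_trans ?_ hdvd
    rw [h3]
    exact Finset.dvd_sum fun i _ => dvd_mul_right _ _
  have := Int.le_of_dvd one_pos h4
  omega

theorem isResolved_iff_det_eq_one (hc : ∀ i, c i ≤ c (τ i) + 1) (h1 : ∀ i, 1 ≤ c i) :
    IsResolved τ c ↔ (intervalMatrix τ c (1 : ℤ)).det = 1 :=
  ⟨fun h => h.det_eq_one hc h1, isResolved_of_det_eq_one hc h1⟩

end Determinant

end NakayamaAlgebra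

namespace NakayamaAlgebra

open CategoryTheory LinearMap

/-! ### Uniserial modules, length and the radical -/

section Length

variable {A : Type u} [Ring A] {M : Type v} [AddCommGroup M] [Module A M]

theorem isNoetherian_isArtinian_of_isFullSeries {s : CompositionSeries (Submodule A M)}
    (hs : IsFullSeries s) : IsNoetherian A M ∧ IsArtinian A M :=
  isFiniteLength_iff_isNoetherian_isArtinian.1 (isFiniteLength_of_exists_compositionSeries ⟨s, hs⟩)

/-- The submodules of a uniserial module form a chain. -/
theorem IsUniserial.le_or_le (h : IsUniserial A M) (N K : Submodule A M) : N ≤ K ∨ K ≤ N := by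
  obtain ⟨s, hs, huniq⟩ := h
  obtain ⟨_, _⟩ := isNoetherian_isArtinian_of_isFullSeries hs
  have key : ∀ N : Submodule A M, ∃ i, s i = N := by
    intro N
    -- Refine the one-term chain N to a composition series through N; by uniqueness it is s.
    obtain ⟨t, i, hti, h1, h2⟩ :=
      LTSeries.exists_relSeries_covBy_and_head_eq_bot_and_last_eq_bot
        (RelSeries.singleton _ N : LTSeries (Submodule A M))
    have hts : (t : CompositionSeries (Submodule A M)) = s := huniq t ⟨h1, h2⟩
    subst hts
    exact ⟨i 0, congrFun hti 0⟩
  obtain ⟨i, rfl⟩ := key N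
  obtain ⟨j, rfl⟩ := key K
  exact (le_total i j).imp (fun h => s.strictMono.monotone h) fun h => s.strictMono.monotone h

theorem length_eq_add_one_of_covBy {N K : Submodule A M} (h : N ⋖ K) :
    Module.length A K = Module.length A N + 1 := by
  have hsimple := (covBy_iff_quot_is_simple h.le).1 h
  rw [Module.length_eq_add_of_exact (Submodule.inclusion h.le) (N.submoduleOf K).mkQ
    (Submodule.inclusion_injective h.le) (Submodule.mkQ_surjective _)]
  · congr 1
    exact Module.length_eq_one_iff.2 hsimple
  · rw [LinearMap.exact_iff, Submodule.ker_mkQ, Submodule.range_inclusion]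
    rfl

theorem length_series {s : CompositionSeries (Submodule A M)} (hs : s.head = ⊥)
    (i : Fin (s.length + 1)) : Module.length A (s i) = (i : ℕ) := by
  induction i using Fin.induction with
  | zero =>
    have : s 0 = ⊥ := hs
    rw [this]
    simp
  | succ i ih => simp [length_eq_add_one_of_covBy (s.step i), ih]

theorem length_add_length_ker {N : Type*} [AddCommGroup N] [Module A N] {g : M →ₗ[A] N}
    (hg : Function.Surjective g) :
    Module.length A M = Module.length A (ker g) + Module.length A N :=
  Module.length_eq_add_of_exact (ker g).subtype g (Submodule.subtype_injective _) hg
    (LinearMap.exact_subtype_ker_map g)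

theorem length_lt_of_lt [IsArtinian A M] [IsNoetherian A M] {N K : Submodule A M} (h : N < K) :
    Module.length A N < Module.length A K := by
  rw [Module.length_submodule, Module.length_submodule]
  exact Submodule.height_strictMono h

/-- The `k`-th power of the Jacobson radical annihilates modules of length at most `k`. -/
theorem jacobson_pow_smul_eq_bot [IsArtinian A M] [IsNoetherian A M] (k : ℕ) (N : Submodule A M)
    (hN : Module.length A N ≤ k) : Ring.jacobson A ^ k • N = ⊥ := by
  induction k generalizing N with
  | zero =>
    have : N = ⊥ := by
      rw [← Submodule.subsingleton_iff_eq_bot, ← Module.length_eq_zero_iff (R := A)]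
      exact le_antisymm (by exact_mod_cast hN) bot_le
    rw [this, Submodule.smul_bot]
  | succ k ih =>
    by_cases h0 : N = ⊥
    · rw [h0, Submodule.smul_bot]
    · rw [Submodule.pow_succ, Submodule.mul_smul]
      refine ih _ (Order.le_of_lt_add_one (lt_of_lt_of_le
        (length_lt_of_lt (Submodule.FG.jacobson_smul_lt h0 (IsNoetherian.noetherian N))) ?_))
      exact_mod_cast hN

end Length

/-! ### Projective covers of simple modules -/

section Cover

variable {A : Type u} [Ring A] {P S : Type v} [AddCommGroup P] [Module A P] [AddCommGroup S]
  [Module A S] {f : P →ₗ[A] S}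

theorem IsProjectiveCover.isCoatom_ker [IsSimpleModule A S] (hf : IsProjectiveCover f) :
    IsCoatom (ker f) := by
  rw [← isSimpleModule_iff_isCoatom]
  exact IsSimpleModule.congr (f.quotKerEquivOfSurjective hf.surjective)

/-- The projective cover of a simple module is local. -/
theorem IsProjectiveCover.le_ker [IsSimpleModule A S] (hf : IsProjectiveCover f)
    {N : Submodule A P} (hN : N ≠ ⊤) : N ≤ ker f := by
  by_contra hle
  exact hN (hf.superfluous N (hf.isCoatom_ker.2 _ (right_lt_sup.2 hle)))

theorem IsProjectiveCover.nonempty_equiv [IsSimpleModule A S] (hf : IsProjectiveCover f)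
    {T : Type*} [AddCommGroup T] [Module A T] [IsSimpleModule A T] {g : P →ₗ[A] T}
    (hg : Function.Surjective g) : Nonempty (T ≃ₗ[A] S) := by
  have hc : IsCoatom (ker g) := by
    rw [← isSimpleModule_iff_isCoatom]
    exact IsSimpleModule.congr (g.quotKerEquivOfSurjective hg)
  have hker : ker g = ker f :=
    (hf.le_ker hc.1).eq_or_lt.resolve_right fun h => hf.isCoatom_ker.1 (hc.2 _ h)
  exact ⟨(g.quotKerEquivOfSurjective hg).symm ≪≫ₗ Submodule.quotEquivOfEq _ _ hker ≪≫ₗ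
    f.quotKerEquivOfSurjective hf.surjective⟩

/-- Any element outside the largest proper submodule generates P. -/
theorem IsProjectiveCover.finite [IsSimpleModule A S] (hf : IsProjectiveCover f) :
    Module.Finite A P := by
  have := IsSimpleModule.nontrivial A S
  obtain ⟨y, hy⟩ := exists_ne (0 : S)
  obtain ⟨x, rfl⟩ := hf.surjective y
  refine ⟨⟨{x}, ?_⟩⟩
  by_contra h
  rw [Finset.coe_singleton] at h
  exact hy (hf.le_ker h (Submodule.mem_span_singleton_self x))

theorem IsProjectiveCover.isIndecomposable [IsSimpleModule A S] (hf : IsProjectiveCover f) :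
    IsIndecomposable A P := by
  have := IsSimpleModule.nontrivial A S
  refine ⟨hf.surjective.nontrivial, fun N K h => ?_⟩
  by_cases hN : N = ⊤
  · exact Or.inr (by simpa [hN] using h.inf_eq_bot)
  · by_cases hK : K = ⊤
    · exact Or.inl (by simpa [hK] using h.inf_eq_bot)
    · refine absurd (h.sup_eq_top) (ne_of_lt (lt_of_le_of_lt (sup_le (hf.le_ker hN) (hf.le_ker hK))
        hf.isCoatom_ker.1.lt_top))

end Cover

/-! ### Covering the radicals of the projectives -/

section System

/-- Projective covers `P j` of the simple modules `S j` whose submodules form chains, with indices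
`τ j` such that `P (τ j)` covers the radical of `P j`. -/
structure CoverSystem (A : Type u) [Ring A] {n : ℕ} (S P : Fin n → ModuleCat.{u} A) where
  f : ∀ j, P j →ₗ[A] S j
  simples : IsCompleteSimples A S
  cover : ∀ j, IsProjectiveCover (f j)
  le_or_le : ∀ j (N K : Submodule A (P j)), N ≤ K ∨ K ≤ N
  τ : Fin n → Fin n
  exists_range_eq : ∀ j, ker (f j) ≠ ⊥ → ∃ h : P (τ j) →ₗ[A] P j, range h = ker (f j)

variable {A : Type u} [Ring A] {n : ℕ} {S P : Fin n → ModuleCat.{u} A}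

/-- Lift the projective cover of the simple module M/N along M → M/N. -/
theorem IsCompleteSimples.exists_hom_range_not_le (hS : IsCompleteSimples A S)
    {f : ∀ j, P j →ₗ[A] S j} (hf : ∀ j, IsProjectiveCover (f j)) {M : Type u} [AddCommGroup M]
    [Module A M] {N : Submodule A M} (hN : IsCoatom N) :
    ∃ j, ∃ g : P j →ₗ[A] M, ¬ range g ≤ N := by
  have hsimple := isSimpleModule_iff_isCoatom.2 hN
  obtain ⟨j, ⟨e⟩⟩ := hS.complete (M ⧸ N) hsimple
  have := (hf j).projective
  obtain ⟨g, hg⟩ := Module.projective_lifting_property N.mkQ (e.symm.toLinearMap ∘ₗ f j)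
    N.mkQ_surjective
  refine ⟨j, g, fun hle => ?_⟩
  have := IsSimpleModule.nontrivial A (M ⧸ N)
  obtain ⟨y, hy⟩ := exists_ne (0 : M ⧸ N)
  obtain ⟨x, hx⟩ := (e.symm.surjective.comp (hf j).surjective) y
  have h2 : N.mkQ (g x) = y := (LinearMap.congr_fun hg x).trans hx
  refine hy (h2.symm.trans ?_)
  rw [Submodule.mkQ_apply, Submodule.Quotient.mk_eq_zero]
  exact hle (mem_range_self g x)

theorem exists_coverSystem [IsArtinianRing A] (hS : IsCompleteSimples A S)
    (hP : ∀ j, ∃ f : P j →ₗ[A] S j, IsProjectiveCover f)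
    (huni : ∀ (M : Type u) [AddCommGroup M] [Module A M], Module.Finite A M →
      IsIndecomposable A M → Module.Projective A M → IsUniserial A M) :
    Nonempty (CoverSystem A S P) := by
  choose f hf using hP
  have := hS.simple
  have hfin : ∀ j, Module.Finite A (P j) := fun j => (hf j).finite
  have htot : ∀ j (N K : Submodule A (P j)), N ≤ K ∨ K ≤ N := fun j =>
    (huni _ (hfin j) (hf j).isIndecomposable (hf j).projective).le_or_le
  have hτ : ∀ j, ∃ j', ker (f j) ≠ ⊥ → ∃ h : P j' →ₗ[A] P j, range h = ker (f j) := by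
    intro j
    by_cases hker : ker (f j) = ⊥
    -- For P j simple, τ j = j is a harmless filler: the inequality on lengths still holds, and only
    -- position 0 contributes a factor of P j.
    · exact ⟨j, fun h => absurd hker h⟩
    · obtain ⟨N, -, hN⟩ := exists_le_covBy_of_lt (bot_lt_iff_ne_bot.2 hker)
      have hN' : IsCoatom (N.submoduleOf (ker (f j))) :=
        isSimpleModule_iff_isCoatom.1 ((covBy_iff_quot_is_simple hN.le).1 hN)
      obtain ⟨j', g, hg⟩ := hS.exists_hom_range_not_le hf hN'
      refine ⟨j', fun _ => ⟨(ker (f j)).subtype ∘ₗ g, ?_⟩⟩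
      have hle : range ((ker (f j)).subtype ∘ₗ g) ≤ ker (f j) := by
        rintro _ ⟨x, rfl⟩
        exact (g x).2
      have hnle : ¬ range ((ker (f j)).subtype ∘ₗ g) ≤ N := fun h => hg <| by
        rintro _ ⟨x, rfl⟩
        exact h ⟨x, rfl⟩
      -- In the chain of submodules, an image inside the radical but not inside its maximal
      -- submodule N is the whole radical.
      rcases htot j N (range ((ker (f j)).subtype ∘ₗ g)) with h | h
      · exact (hN.eq_or_eq h hle).resolve_left fun h' => hnle h'.le
      · exact absurd h hnle
  choose τ hτ using hτ
  exact ⟨⟨f, hS, hf, htot, τ, hτ⟩⟩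

end System

end NakayamaAlgebra

namespace NakayamaAlgebra

open CategoryTheory LinearMap

/-! ### From modules to intervals -/

namespace CoverSystem

variable {A : Type u} [Ring A] {n : ℕ} {S P : Fin n → ModuleCat.{u} A} (D : CoverSystem A S P)

theorem finite (D : CoverSystem A S P) (j : Fin n) : Module.Finite A (P j) :=
  have := D.simples.simple j
  (D.cover j).finite

/-- The composition length of `P j`. -/
noncomputable def len (_ : CoverSystem A S P) (j : Fin n) : ℕ := (Module.length A (P j)).toNat

/-- A maximal submodule of an image of P j is the image of its radical, which P (τ j) covers. -/
theorem exists_range_eq_of_covBy {j : Fin n} {M : Type u} [AddCommGroup M] [Module A M]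
    {g : P j →ₗ[A] M} {N : Submodule A M} (hN : N ⋖ range g) (h0 : N ≠ ⊥) :
    ∃ h : P (D.τ j) →ₗ[A] M, range h = N := by
  have := D.simples.simple j
  have hmap : Submodule.map g (Submodule.comap g N) = N := by
    rw [Submodule.map_comap_eq, inf_eq_right.2 hN.le]
  have hle : Submodule.comap g N ≤ ker (D.f j) := by
    refine (D.cover j).le_ker fun h => hN.ne ?_
    rw [← hmap, h, Submodule.map_top]
  have hN' : Submodule.map g (ker (D.f j)) = N := by
    refine (hN.eq_or_eq (hmap.symm.le.trans (Submodule.map_mono hle)) map_le_range).resolve_right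
      fun h => ?_
    have h2 : ker (D.f j) ⊔ ker g = ⊤ := by
      rw [← Submodule.comap_map_eq, h, ← Submodule.map_top, Submodule.comap_map_eq, top_sup_eq]
    have h3 := (D.cover j).superfluous (ker g) (by rwa [sup_comm] at h2)
    rw [ker_eq_top.1 h3, range_zero] at hN
    exact not_lt_bot hN.lt
  have hker : ker (D.f j) ≠ ⊥ := fun h => h0 (by rw [← hN', h, Submodule.map_bot])
  obtain ⟨h, hh⟩ := D.exists_range_eq j hker
  exact ⟨g ∘ₗ h, by rw [range_comp, hh, hN']⟩

variable [IsArtinianRing A]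

theorem coe_len (j : Fin n) : (D.len j : ℕ∞) = Module.length A (P j) := by
  have := D.finite j
  exact ENat.natCast_toNat Module.length_ne_top

theorem one_le_len (j : Fin n) : 1 ≤ D.len j := by
  have := D.simples.simple j
  have := IsSimpleModule.nontrivial A (S j)
  have := (D.cover j).surjective.nontrivial
  have h := Module.length_pos (R := A) (M := P j)
  rw [← D.coe_len j] at h
  exact_mod_cast h

theorem len_le (j : Fin n) : D.len j ≤ D.len (D.τ j) + 1 := by
  have := D.simples.simple j
  have h := length_add_length_ker (D.cover j).surjective
  rw [Module.length_eq_one A (S j), ← D.coe_len j] at h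
  have h2 : Module.length A (ker (D.f j)) ≤ D.len (D.τ j) := by
    by_cases h0 : ker (D.f j) = ⊥
    · rw [h0, Module.length_bot]
      exact bot_le
    · obtain ⟨g, hg⟩ := D.exists_range_eq j h0
      rw [D.coe_len, ← hg]
      exact Module.length_le_of_surjective g.rangeRestrict g.surjective_rangeRestrict
  have h3 : (D.len j : ℕ∞) ≤ D.len (D.τ j) + 1 := by
    rw [h]
    gcongr
  exact_mod_cast h3

theorem exists_range_eq_of_length {k : Fin n} (a : ℕ) {N : Submodule A (P k)} (h0 : N ≠ ⊥)
    (hN : Module.length A N + a = D.len k) :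
    ∃ g : P (D.τ^[a] k) →ₗ[A] P k, range g = N := by
  have := D.finite k
  induction a generalizing N with
  | zero =>
    have hN' : N = ⊤ := by
      by_contra h
      have := Submodule.length_lt h
      rw [← D.coe_len, ← hN] at this
      simp at this
    exact ⟨(LinearMap.id : P k →ₗ[A] P k), range_id.trans hN'.symm⟩
  | succ a ih =>
    have hne : N ≠ ⊤ := by
      rintro rfl
      rw [Module.length_top, ← D.coe_len] at hN
      norm_cast at hN
      omega
    obtain ⟨K, hK, -⟩ := exists_covBy_le_of_lt hne.lt_top
    obtain ⟨g, rfl⟩ := ih (N := K) (ne_bot_of_gt hK.lt) (by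
      rw [length_eq_add_one_of_covBy hK, ← hN]
      push_cast
      ring)
    rw [Function.iterate_succ_apply']
    exact D.exists_range_eq_of_covBy hK h0

theorem multiplicity_eq_card (j k : Fin n) :
    multiplicity A (S j) (P k) =
      ((Finset.range (D.len k)).filter fun a => D.τ^[a] k = j).card := by
  have := D.finite k
  obtain ⟨s, hs⟩ := exists_compositionSeries_of_isNoetherian_isArtinian A (P k)
  rw [multiplicity_eq hs]
  have hlen : s.length = D.len k := by
    have h := Module.length_compositionSeries s hs.1 hs.2
    rw [← D.coe_len] at h
    exact_mod_cast h
  -- The series climbs from the socle while τ descends from the top, hence the reversed index.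
  have hfac : ∀ i : Fin s.length,
      Nonempty ((s i.succ ⧸ (s i.castSucc).submoduleOf (s i.succ)) ≃ₗ[A] S j) ↔
        D.τ^[s.length - 1 - i] k = j := by
    intro i
    obtain ⟨g, hg⟩ := D.exists_range_eq_of_length (s.length - 1 - i) (N := s i.succ)
      (ne_bot_of_gt (s.step i).lt) (by
        rw [length_series hs.1, ← hlen, ← Nat.cast_add, Fin.val_succ]
        congr 1
        omega)
    have := D.simples.simple (D.τ^[s.length - 1 - i] k)
    have : IsSimpleModule A (s i.succ ⧸ (s i.castSucc).submoduleOf (s i.succ)) :=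
      (covBy_iff_quot_is_simple (s.step i).le).1 (s.step i)
    rw [← hg] at this ⊢
    obtain ⟨e⟩ := (D.cover _).nonempty_equiv
      (g := ((s i.castSucc).submoduleOf (range g)).mkQ ∘ₗ g.rangeRestrict)
      ((Submodule.mkQ_surjective _).comp g.surjective_rangeRestrict)
    refine ⟨fun ⟨e'⟩ => D.simples.injective _ _ ⟨e.symm ≪≫ₗ e'⟩, ?_⟩
    rintro rfl
    exact ⟨e⟩
  rw [factorCount, Nat.card_congr (Equiv.subtypeEquivRight hfac), ← hlen, Nat.card_eq_fintype_card,
    Fintype.card_subtype]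
  refine Finset.card_bij (fun i _ => s.length - 1 - i) ?_ ?_ ?_
  · intro i hi
    simp only [Finset.mem_filter, Finset.mem_univ, true_and, Finset.mem_range] at hi ⊢
    exact ⟨by omega, hi⟩
  · intro i _ i' _ h
    ext
    omega
  · intro a ha
    simp only [Finset.mem_filter, Finset.mem_range] at ha
    refine ⟨⟨s.length - 1 - a, by omega⟩, ?_, by simp only []; omega⟩
    simp only [Finset.mem_filter, Finset.mem_univ, true_and]
    rw [show s.length - 1 - (s.length - 1 - a) = a by omega]
    exact ha.2

theorem cartanMatrix_eq : cartanMatrix A S P = intervalMatrix D.τ D.len (1 : ℤ) := by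
  ext j k
  simp [cartanMatrix, intervalMatrix, D.multiplicity_eq_card]

theorem projective_of_length_eq {k : Fin n} {M : Type u} [AddCommGroup M] [Module A M]
    (hM : Module.length A M = D.len k) {g : P k →ₗ[A] M} (hg : Function.Surjective g) :
    Module.Projective A M := by
  have := (D.cover k).projective
  have h0 := length_add_length_ker hg
  rw [hM, ← D.coe_len] at h0
  have h1 : Module.length A (ker g) = 0 := by
    refine (ENat.add_left_injective_of_ne_top (ENat.natCast_ne_top (D.len k))) ?_
    simpa using h0.symm
  rw [Module.length_eq_zero_iff, Submodule.subsingleton_iff_eq_bot, ker_eq_bot] at h1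
  exact Module.Projective.of_equiv (LinearEquiv.ofBijective g ⟨h1, hg⟩)

/-- The combinatorial resolutions compute projective dimensions. -/
theorem resolvesIn_iff (d : ℕ) {k : Fin n} {l : ℕ} (hl : 1 ≤ l) {M : Type u} [AddCommGroup M]
    [Module A M] (hM : Module.length A M = l) {g : P k →ₗ[A] M} (hg : Function.Surjective g) :
    ResolvesIn D.τ D.len d k l ↔ HasProjectiveDimensionLE (ModuleCat.of A M) d := by
  induction d generalizing k l M with
  | zero =>
    have := (D.cover k).projective
    have hlen := length_add_length_ker hg
    rw [hM, ← D.coe_len] at hlen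
    rw [← projective_iff_hasProjectiveDimensionLE_zero, ← IsProjective.iff_projective]
    refine ⟨fun h => D.projective_of_length_eq (h ▸ hM) hg, fun hp => ?_⟩
    obtain ⟨h, hh⟩ := Module.projective_lifting_property g LinearMap.id hg
    have hgh : ∀ x, g (h x) = x := fun x => LinearMap.congr_fun hh x
    -- A splitting makes ker g and range h complementary, yet they are comparable; so one vanishes,
    -- and M ≠ 0 leaves only ker g.
    have hker : ker g = ⊥ := by
      rcases D.le_or_le k (ker g) (range h) with hle | hle
      · rw [eq_bot_iff]
        intro x hx
        obtain ⟨y, rfl⟩ := hle hx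
        rw [mem_ker, hgh] at hx
        simp [hx]
      · have h0 : ∀ x : M, x = 0 := fun x => by
          rw [← hgh x]
          exact hle (mem_range_self h x)
        have : Subsingleton M := ⟨fun x y => (h0 x).trans (h0 y).symm⟩
        rw [Module.length_eq_zero] at hM
        norm_cast at hM
        omega
    rw [hker, Module.length_bot, zero_add] at hlen
    exact_mod_cast hlen.symm
  | succ d ih =>
    have := (D.cover k).projective
    have hlen := length_add_length_ker hg
    rw [hM, ← D.coe_len] at hlen
    by_cases hlk : l = D.len k
    · have := D.projective_of_length_eq (hlk ▸ hM) hg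
      have : Projective (ModuleCat.of A M) := (IsProjective.iff_projective M).1 this
      have : HasProjectiveDimensionLE (ModuleCat.of A M) (d + 1) :=
        hasProjectiveDimensionLT_of_ge _ 1 _ (by omega)
      exact iff_of_true (Or.inl hlk) this
    · have := D.finite k
      obtain ⟨m, hm⟩ := ENat.ne_top_iff_exists.1
        (Module.length_ne_top (R := A) (M := ker g))
      rw [← hm] at hlen
      have hlen' : D.len k = m + l := by exact_mod_cast hlen
      have h0 : ker g ≠ ⊥ := by
        intro h
        rw [h, Module.length_bot] at hm
        norm_cast at hm
        omega
      -- The syzygy has colength l in P k, so it is the interval with top τ^l k and length c_k - l.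
      obtain ⟨g', hg'⟩ := D.exists_range_eq_of_length l h0 (by rw [← hm, ← hlen])
      have hP : Projective (P k) := (IsProjective.iff_projective (P k)).1 ‹_›
      have hS := LinearMap.shortExact_shortComplexKer hg
      have h2 := hS.hasProjectiveDimensionLT_X₃_iff d hP
      have h3 := ih (k := D.τ^[l] k) (l := D.len k - l) (M := ker g) (by omega)
        (by rw [← hm]; congr 1; omega)
        (g := g'.codRestrict (ker g) fun x => hg' ▸ mem_range_self g' x) (fun y => by
          obtain ⟨x, hx⟩ : (y : P k) ∈ range g' := by
            rw [hg']
            exact y.2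
          exact ⟨x, Subtype.ext hx⟩)
      rw [ResolvesIn, or_iff_right hlk, h3]
      exact h2.symm

end CoverSystem

end NakayamaAlgebra

namespace NakayamaAlgebra

open CategoryTheory LinearMap

/-! ### Global dimension and Loewy length -/

section GlobalDimension

variable {A : Type u} [Ring A] {n : ℕ} {S P : Fin n → ModuleCat.{u} A}

theorem IsCompleteSimples.hasProjectiveDimensionLE (hS : IsCompleteSimples A S) {d : ℕ}
    (hd : ∀ j, HasProjectiveDimensionLE (S j) d) {M : Type u} [AddCommGroup M] [Module A M]
    (hM : IsFiniteLength A M) : HasProjectiveDimensionLE (ModuleCat.of A M) d := by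
  induction hM with
  | @of_subsingleton M _ _ _ =>
    have := (ModuleCat.isZero_of_subsingleton (ModuleCat.of A M)).hasProjectiveDimensionLT_zero
    exact hasProjectiveDimensionLT_of_ge _ 0 _ (Nat.zero_le _)
  | @of_simple_quotient M _ _ N hsimple _ ih =>
    obtain ⟨j, ⟨e⟩⟩ := hS.complete (M ⧸ N) hsimple
    have := hd j
    have hq : HasProjectiveDimensionLE (ModuleCat.of A (M ⧸ N)) d :=
      hasProjectiveDimensionLT_of_iso (LinearEquiv.toModuleIso e.symm : S j ≅ _) _
    have hk : HasProjectiveDimensionLE (ModuleCat.of A (ker N.mkQ)) d :=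
      hasProjectiveDimensionLT_of_iso
        (LinearEquiv.toModuleIso (LinearEquiv.ofEq _ _ N.ker_mkQ.symm)) _
    exact (LinearMap.shortExact_shortComplexKer N.mkQ_surjective).hasProjectiveDimensionLT_X₂ _
      hk hq

theorem IsCompleteSimples.globalDimension_le [IsArtinianRing A] (hS : IsCompleteSimples A S)
    {d : ℕ} (hd : ∀ j, HasProjectiveDimensionLE (S j) d) : globalDimension A ≤ d := by
  refine iSup₂_le fun M hM => ?_
  rw [projectiveDimension_le_iff]
  exact hS.hasProjectiveDimensionLE hd
    (isFiniteLength_iff_isNoetherian_isArtinian.2 ⟨inferInstance, inferInstance⟩)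

theorem exists_hasProjectiveDimensionLE (h : globalDimension A < ⊤) (M : ModuleCat.{u} A)
    (hM : Module.Finite A M) : ∃ d, HasProjectiveDimensionLE M d := by
  rw [← projectiveDimension_ne_top_iff]
  exact ((le_iSup₂ (f := fun (M : ModuleCat.{u} A) (_ : Module.Finite A M) =>
    projectiveDimension M) M hM).trans_lt h).ne

end GlobalDimension

namespace CoverSystem

variable {A : Type u} [Ring A] [IsArtinianRing A] {n : ℕ} {S P : Fin n → ModuleCat.{u} A}
  (D : CoverSystem A S P)

theorem resolvesIn_one_iff (d : ℕ) (j : Fin n) :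
    ResolvesIn D.τ D.len d j 1 ↔ HasProjectiveDimensionLE (S j) d := by
  have := D.simples.simple j
  exact D.resolvesIn_iff d le_rfl (by simp)
    (D.cover j).surjective

theorem globalDimension_le_of_isResolved (h : IsResolved D.τ D.len) :
    globalDimension A ≤ ((2 * n - 2 : ℕ) : WithBot ℕ∞) :=
  D.simples.globalDimension_le fun j => by
    have h2 := h.resolvesIn D.len_le D.one_le_len j
    rw [Fintype.card_fin] at h2
    exact (D.resolvesIn_one_iff _ j).1 h2

theorem globalDimension_lt_top_iff : globalDimension A < ⊤ ↔ IsResolved D.τ D.len := by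
  refine ⟨fun h j => ?_, fun h => (D.globalDimension_le_of_isResolved h).trans_lt ?_⟩
  · have := D.simples.simple j
    obtain ⟨d, hd⟩ := exists_hasProjectiveDimensionLE h (S j) inferInstance
    exact ⟨d, (D.resolvesIn_one_iff d j).2 hd⟩
  · exact WithBot.coe_lt_coe.2 (ENat.natCast_lt_top _)

/-- The regular module is a sum of images of the P j, each killed by the k-th power of the radical.
-/
theorem jacobson_pow_eq_bot {k : ℕ} (hk : ∀ j, D.len j ≤ k) : Ring.jacobson A ^ k = ⊥ := by
  have hT : ⨆ j, ⨆ g : P j →ₗ[A] A, range g = ⊤ := by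
    by_contra h
    obtain ⟨N, hN, hle⟩ := (eq_top_or_exists_le_coatom _).resolve_left h
    obtain ⟨j, g, hg⟩ := D.simples.exists_hom_range_not_le D.cover hN
    exact hg ((le_iSup₂ (f := fun j (g : P j →ₗ[A] A) => range g) j g).trans hle)
  have hz : Ring.jacobson A ^ k • (⊤ : Submodule A A) = ⊥ := by
    rw [← hT, Submodule.smul_iSup, iSup_eq_bot]
    intro j
    rw [Submodule.smul_iSup, iSup_eq_bot]
    intro g
    have := D.finite j
    rw [← Submodule.map_top, ← Submodule.map_smul'', jacobson_pow_smul_eq_bot, Submodule.map_bot]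
    rw [Module.length_top, ← D.coe_len]
    exact_mod_cast hk j
  rw [eq_bot_iff, ← hz]
  intro x hx
  simpa using Submodule.smul_mem_smul hx (Submodule.mem_top (x := (1 : A)))

end CoverSystem

end NakayamaAlgebra

theorem mainTheorem10 {R : Type v} {A : Type u} [CommRing R] [IsArtinianRing R] [Ring A]
    [Algebra R A] [Module.Finite R A]
    (hconn : NakayamaAlgebra.IsConnected A) (hnak : NakayamaAlgebra.IsNakayama A)
    {n : ℕ} (S P : Fin n → ModuleCat.{u} A)
    (hS : NakayamaAlgebra.IsCompleteSimples A S)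
    (hP : ∀ j, ∃ f : P j →ₗ[A] S j, NakayamaAlgebra.IsProjectiveCover f) :
    (NakayamaAlgebra.globalDimension A < ⊤ ↔ (NakayamaAlgebra.cartanMatrix A S P).det = 1) ∧
    (NakayamaAlgebra.globalDimension A < ⊤ →
      NakayamaAlgebra.globalDimension A ≤ ((2 * n - 2 : ℕ) : WithBot ℕ∞) ∧
      (⨆ j, Module.length A (P j)) ≤ ((2 * n - 1 : ℕ) : ℕ∞) ∧
      NakayamaAlgebra.loewyLength A ≤ 2 * n - 1) := by
  have : IsArtinianRing A := isArtinian_of_tower R inferInstance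
  obtain ⟨D⟩ := NakayamaAlgebra.exists_coverSystem hS hP hnak.uniserial_of_projective
  rw [D.cartanMatrix_eq, D.globalDimension_lt_top_iff]
  refine ⟨NakayamaAlgebra.isResolved_iff_det_eq_one D.len_le D.one_le_len, fun h => ?_⟩
  have hlen : ∀ j, D.len j ≤ 2 * n - 1 := fun j => by
    simpa using h.length_le D.len_le D.one_le_len j
  refine ⟨D.globalDimension_le_of_isResolved h, iSup_le fun j => ?_,
    Nat.sInf_le (D.jacobson_pow_eq_bot hlen)⟩
  rw [← D.coe_len]
  exact_mod_cast hlen j
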